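/- Theorem 5.1. A *dimension group* is a partially ordered abelian group $G$ that is directed (every element is a difference of elements of $G^+=\{g : g\ge 0\}$), unperforated (if $n\ge 1$ is an integer and $ng\ge 0$, then $g\ge 0$), and has the Riesz interpolation property (if $a,b\le c,d$, then there is $e$ with $a,b\le e\le c,d$). It is *simple* if it is nonzero and its only order ideals (convex directed subgroups) are $\{0\}$ and $G$. A *trace* on $G$ is a nonzero group homomorphism $\tau: G\to\mathbf{R}$ with $\tau(G^+)\subseteq[0,\infty)$; $G$ has *unique trace* if a trace exists and any two traces are positive real multiples of each other. Let $G$ be a countable simple dimension group with unique trace. Then $G$ is co-rank one ultrasimplicial; that is, there are a function $f:\mathbf{N}\to\mathbf{N}$ (where $0 \in \mathbf{N}$) and integer matrices $A_n$ of size $f(n+1)\times f(n)$ ($n\in\mathbf{N}$) with nonnegative entries such that (i) $G$ is isomorphic, as a partially ordered abelian group, to the direct limit $\varinjlim\,(A_n:\mathbf{Z}^{f(n)}\to\mathbf{Z}^{f(n+1)})$ with the direct limit ordering, whose positive cone consists of the classes $[v,n]$ with $v\in\mathbf{Z}^{f(n)}$ having all entries nonnegative; and (ii) for all $m\ge n$,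 the kernel of the telescoped product $A_mA_{m-1}\cdots A_{n+1}A_n:\mathbf{Z}^{f(n)}\to\mathbf{Z}^{f(m+1)}$ is a free abelian group of rank at most one. -/

import Mathlib

/-- Dimension group, in the axiomatic form: a directed, unperforated partially ordered abelian group
with the Riesz interpolation property. -/
structure IsDimensionGroup (G : Type*) [AddCommGroup G] [PartialOrder G] [IsOrderedAddMonoid G] :
    Prop where
  directed : ∀ g : G, ∃ a b : G, 0 ≤ a ∧ 0 ≤ b ∧ g = a - b
  unperforated : ∀ (n : ℕ) (g : G), 0 < n → 0 ≤ n • g → 0 ≤ g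
  interpolation : ∀ a b c d : G, a ≤ c → a ≤ d → b ≤ c → b ≤ d →
    ∃ e : G, a ≤ e ∧ b ≤ e ∧ e ≤ c ∧ e ≤ d

/-- Order ideal: a convex directed subgroup. -/
structure IsOrderIdeal {G : Type*} [AddCommGroup G] [PartialOrder G] [IsOrderedAddMonoid G]
    (H : AddSubgroup G) : Prop where
  convex : ∀ x y : G, 0 ≤ x → x ≤ y → y ∈ H → x ∈ H
  directed : ∀ h ∈ H, ∃ a ∈ H, ∃ b ∈ H, 0 ≤ a ∧ 0 ≤ b ∧ h = a - b

/-- Simplicity of a partially ordered group: it is nonzero and its only order ideals are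
the trivial ones. -/
structure IsSimpleOrderedGroup (G : Type*) [AddCommGroup G] [PartialOrder G]
    [IsOrderedAddMonoid G] : Prop where
  nontrivial : Nontrivial G
  eq_bot_or_eq_top : ∀ H : AddSubgroup G, IsOrderIdeal H → H = ⊥ ∨ H = ⊤

/-- Trace: a nonzero positive group homomorphism to the reals. -/
structure IsTrace {G : Type*} [AddCommGroup G] [PartialOrder G] [IsOrderedAddMonoid G]
    (τ : G →+ ℝ) : Prop where
  nonneg : ∀ g : G, 0 ≤ g → 0 ≤ τ g
  ne_zero : τ ≠ 0

/-- There is a trace, and it is unique up to multiplication by a positive real. -/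
structure HasUniqueTrace (G : Type*) [AddCommGroup G] [PartialOrder G] [IsOrderedAddMonoid G] :
    Prop where
  exists_trace : ∃ τ : G →+ ℝ, IsTrace τ
  unique : ∀ τ τ' : G →+ ℝ, IsTrace τ → IsTrace τ' → ∃ c : ℝ, 0 < c ∧ ∀ g : G, τ' g = c * τ g

section MatrixSequence

variable {f : ℕ → ℕ} (A : ∀ n : ℕ, Matrix (Fin (f (n + 1))) (Fin (f n)) ℤ)

/-- The telescoped product `A (m - 1) * ⋯ * A (n + 1) * A n`, from level `n` to level `m`
(the identity matrix if `m = n`). -/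
def telescopedProduct {n m : ℕ} (h : n ≤ m) : Matrix (Fin (f m)) (Fin (f n)) ℤ :=
  Nat.leRecOn (C := fun k => Matrix (Fin (f k)) (Fin (f n)) ℤ) h (fun {k} M => A k * M) 1

/-- The map of free abelian groups `x ↦ A (m - 1) ⋯ A n x` given by the telescoped product. -/
def telescopedMap (n m : ℕ) (h : n ≤ m) : (Fin (f n) → ℤ) →ₗ[ℤ] (Fin (f m) → ℤ) :=
  (telescopedProduct A h).mulVecLin

/-- The direct limit of the sequence of abelian groups `A n : ℤ ^ f n → ℤ ^ f (n + 1)`. -/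
abbrev MatrixLimit : Type :=
  Module.DirectLimit (fun n => Fin (f n) → ℤ) (telescopedMap A)

/-- The class `[v, n]` in the direct limit of a vector `v` at level `n`. -/
noncomputable def limitClass (n : ℕ) (v : Fin (f n) → ℤ) : MatrixLimit A :=
  Module.DirectLimit.of ℤ ℕ (fun n => Fin (f n) → ℤ) (telescopedMap A) n v

/-- The positive cone of the direct limit ordering: the classes of the vectors that are
nonnegative for the coordinatewise ordering. -/
def limitCone : Set (MatrixLimit A) :=
  {x | ∃ (n : ℕ) (v : Fin (f n) → ℤ), 0 ≤ v ∧ limitClass A n v = x}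

end MatrixSequence

/-- `G` is isomorphic, as a partially ordered group, to the ordered direct limit of a sequence of
nonnegative integer matrices, all of whose telescoped products have kernel of rank at most one. -/
def IsCoRankOneUltrasimplicial (G : Type*) [AddCommGroup G] [PartialOrder G]
    [IsOrderedAddMonoid G] : Prop :=
  ∃ (f : ℕ → ℕ) (A : ∀ n : ℕ, Matrix (Fin (f (n + 1))) (Fin (f n)) ℤ),
    (∀ n i j, 0 ≤ A n i j) ∧
    (∃ e : G ≃+ MatrixLimit A, ∀ g : G, 0 ≤ g ↔ e g ∈ limitCone A) ∧
    ∀ (n m : ℕ) (h : n ≤ m), Module.finrank ℤ (LinearMap.ker (telescopedMap A n m h)) ≤ 1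

/-!
By the extension theorem for states, a simple dimension group whose trace `τ` is unique carries the
strict order `0 < g ↔ 0 < τ g`. If `τ` has a least positive value, interpolation makes `τ`
injective and `G` is infinite cyclic. Otherwise the image of `τ` is dense, and a subgroup with
basis `b 0, …, b (r - 1)`, chosen of positive trace, lifts to `ℤ ^ (r + 1)` as follows:
simultaneous Diophantine approximation gives `y` of small trace and integers `n j` for which the
errors `w j = b j - n j • y` have positive trace so much smaller than `τ y` that
`y - M • ∑ j, w j` is positive for a prescribed `M`. With respect to `y - M • ∑ j, w j, w 0, …`,
prescribed positive elements of the subgroup have nonnegative coordinates, while counting ranks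
bounds the relations by one. Iterating along an enumeration of `G` produces the matrices, and the
kernel of each telescoped product consists of relations among one such family.
-/

section States

theorem exists_le_maximal_notMem {M : Type*} [AddZeroClass M] {P : AddSubmonoid M} {x : M}
    (hx : x ∉ P) : ∃ Q, P ≤ Q ∧ Maximal (fun Q : AddSubmonoid M ↦ x ∉ Q) Q :=
  zorn_le_nonempty₀ {Q | x ∉ Q} (fun c hc hchain Q hQ ↦
    ⟨sSup c, fun hmem ↦ by
      obtain ⟨R, hR, hxR⟩ :=
        (AddSubmonoid.mem_sSup_of_directedOn ⟨Q, hQ⟩ hchain.directedOn).1 hmem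
      exact hc hR hxR, fun _ ↦ le_sSup⟩) P hx

variable {G : Type*} [AddCommGroup G] {P : AddSubmonoid G} {u : G}

theorem exists_addMonoidHom_real_nonneg_iff_mem (hspan : P.IsSpanning)
    (harch : ∀ x, ∀ y ∈ P, -y ∉ P → ∃ n : ℕ, n • y - x ∈ P) :
    ∃ σ : G →+ ℝ, ∀ x, 0 ≤ σ x ↔ x ∈ P := by
  classical
  let π := QuotientAddGroup.mk' P.support
  have mem_map {x : G} : π x ∈ P.map π ↔ x ∈ P := by
    refine ⟨?_, AddSubmonoid.mem_map_of_mem π⟩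
    rintro ⟨y, hy, hyx⟩
    have hx : -y + x ∈ P.support := QuotientAddGroup.eq.1 hyx
    simpa using P.add_mem hy (AddSubmonoid.mem_support.1 hx).1
  let cone : AddGroupCone (G ⧸ P.support) :=
    { P.map π with
      eq_zero_of_mem_of_neg_mem' := by
        intro q hq hq'
        obtain ⟨x, rfl⟩ := QuotientAddGroup.mk'_surjective _ q
        rw [← map_neg] at hq'
        exact (QuotientAddGroup.eq_zero_iff x).2
          (AddSubmonoid.mem_support.2 ⟨mem_map.1 hq, mem_map.1 hq'⟩) }
  have : HasMemOrNegMem cone := ⟨fun q ↦ by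
    obtain ⟨x, rfl⟩ := QuotientAddGroup.mk'_surjective _ q
    exact (hspan x).imp mem_map.2 fun h ↦ map_neg π x ▸ mem_map.2 h⟩
  let : LinearOrder (G ⧸ P.support) := LinearOrder.mkOfAddGroupCone cone
  have : IsOrderedAddMonoid (G ⧸ P.support) := IsOrderedAddMonoid.mkOfCone cone
  have le_iff {x y : G} : π x ≤ π y ↔ y - x ∈ P := by
    rw [← mem_map, map_sub]
    rfl
  have : Archimedean (G ⧸ P.support) := ⟨fun q r hr ↦ by
    obtain ⟨x, rfl⟩ := QuotientAddGroup.mk'_surjective _ q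
    obtain ⟨y, rfl⟩ := QuotientAddGroup.mk'_surjective _ r
    rw [← map_zero π, lt_iff_le_not_ge, le_iff, le_iff, sub_zero, zero_sub] at hr
    obtain ⟨n, hn⟩ := harch x y hr.1 hr.2
    exact ⟨n, by rwa [← map_nsmul, le_iff]⟩⟩
  obtain ⟨σ, hσ⟩ := Archimedean.exists_orderAddMonoidHom_real_injective (G ⧸ P.support)
  refine ⟨σ.toAddMonoidHom.comp π, fun x ↦ ?_⟩
  have hmono : StrictMono σ := σ.monotone'.strictMono_of_injective hσ
  calc 0 ≤ σ (π x) ↔ σ (π 0) ≤ σ (π x) := by rw [map_zero, map_zero]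
    _ ↔ x ∈ P := by rw [hmono.le_iff_le, le_iff, sub_zero]

theorem exists_neg_add_nsmul_mem_of_maximal
    (hP : Maximal (fun Q : AddSubmonoid G ↦ -u ∉ Q) P) {x : G} (hx : x ∉ P) :
    ∃ k : ℕ, -(u + k • x) ∈ P := by
  have hmem : -u ∈ P ⊔ AddSubmonoid.multiples x := by
    by_contra h
    exact hx (hP.2 h le_sup_left (AddSubmonoid.mem_sup_right (AddSubmonoid.mem_multiples x)))
  obtain ⟨a, ha, _, ⟨k, rfl⟩, hak⟩ := AddSubmonoid.mem_sup.1 hmem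
  refine ⟨k, ?_⟩
  rwa [neg_add, ← hak, add_neg_cancel_right]

theorem isSpanning_of_maximal (hP : Maximal (fun Q : AddSubmonoid G ↦ -u ∉ Q) P) (hu : u ∈ P) :
    P.IsSpanning := by
  intro x
  by_contra! h
  obtain ⟨k, hk⟩ := exists_neg_add_nsmul_mem_of_maximal hP h.1
  obtain ⟨l, hl⟩ := exists_neg_add_nsmul_mem_of_maximal hP h.2
  rcases k.eq_zero_or_pos with rfl | hk0
  · exact hP.1 (by simpa using hk)
  · -- Eliminating `x` leaves `-(l + k) • u`, and adding `(l + k - 1) • u` to it leaves `-u`.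
    have hmem := P.add_mem (P.add_mem (P.nsmul_mem hk l) (P.nsmul_mem hl k))
      (P.nsmul_mem hu (l + k - 1))
    obtain ⟨k, rfl⟩ := Nat.exists_eq_add_of_le' hk0
    rw [← add_assoc, Nat.add_sub_cancel] at hmem
    refine hP.1 ?_
    convert hmem using 1
    module

theorem exists_nsmul_sub_mem_of_maximal (hP : Maximal (fun Q : AddSubmonoid G ↦ -u ∉ Q) P)
    (hunit : ∀ x, ∃ n : ℕ, n • u - x ∈ P) (x : G) {y : G} (hy : -y ∉ P) :
    ∃ n : ℕ, n • y - x ∈ P := by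
  obtain ⟨k, hk⟩ := exists_neg_add_nsmul_mem_of_maximal hP hy
  obtain ⟨n, hn⟩ := hunit x
  refine ⟨n * k, ?_⟩
  convert P.add_mem (P.nsmul_mem hk n) hn using 1
  module

/-- The extension theorem for states on preordered abelian groups, `P` being the positive cone. -/
theorem exists_addMonoidHom_real_nonneg (hu : u ∈ P) (hneg : -u ∉ P)
    (hunit : ∀ x, ∃ n : ℕ, n • u - x ∈ P) :
    ∃ σ : G →+ ℝ, 0 < σ u ∧ ∀ x ∈ P, 0 ≤ σ x := by
  obtain ⟨Q, hPQ, hQ⟩ := exists_le_maximal_notMem hneg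
  obtain ⟨σ, hσ⟩ := exists_addMonoidHom_real_nonneg_iff_mem (isSpanning_of_maximal hQ (hPQ hu))
    fun x _ _ hy ↦ exists_nsmul_sub_mem_of_maximal hQ
      (fun x ↦ (hunit x).imp fun _ hn ↦ hPQ hn) x hy
  refine ⟨σ, ?_, fun x hx ↦ (hσ x).2 (hPQ hx)⟩
  simpa using (hσ (-u)).not.2 hQ.1

end States

section Traces

variable {G : Type*} [AddCommGroup G] [PartialOrder G] [IsOrderedAddMonoid G]

theorem exists_isTrace_apply_nonpos
    (hunperf : ∀ (n : ℕ) (g : G), 0 < n → 0 ≤ n • g → 0 ≤ g) {u : G} (hu : 0 < u)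
    (hunit : ∀ x : G, ∃ n : ℕ, x ≤ n • u) {g : G} (hg : ¬ 0 ≤ g) :
    ∃ σ : G →+ ℝ, IsTrace σ ∧ σ g ≤ 0 := by
  let P : AddSubmonoid G := AddSubmonoid.nonneg G ⊔ AddSubmonoid.multiples (-g)
  have nonneg_mem {x : G} (hx : 0 ≤ x) : x ∈ P :=
    AddSubmonoid.mem_sup_left (AddSubmonoid.mem_nonneg.2 hx)
  have hneg : -u ∉ P := by
    intro hmem
    obtain ⟨a, ha, _, ⟨k, rfl⟩, hak⟩ := AddSubmonoid.mem_sup.1 hmem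
    have ha : 0 ≤ a := ha
    have hkg : k • g = a + u := by
      rw [← neg_neg u, ← hak]
      simp
    have hkg_pos : 0 < k • g := hkg ▸ add_pos_of_nonneg_of_pos ha hu
    have hk : k ≠ 0 := by
      rintro rfl
      simp at hkg_pos
    exact hg (hunperf k g hk.bot_lt hkg_pos.le)
  obtain ⟨σ, hσu, hσ⟩ := exists_addMonoidHom_real_nonneg (nonneg_mem hu.le) hneg
    fun x ↦ (hunit x).imp fun n hn ↦ nonneg_mem (sub_nonneg.2 hn)
  refine ⟨σ, ⟨fun x hx ↦ hσ x (nonneg_mem hx), ?_⟩, ?_⟩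
  · rintro rfl
    simp at hσu
  · simpa using hσ (-g) (AddSubmonoid.mem_sup_right (AddSubmonoid.mem_multiples (-g)))

/-- The order ideal generated by a positive element `u`. -/
def principalOrderIdeal (u : G) : AddSubgroup G where
  carrier := {x | ∃ n : ℕ, -(n • u) ≤ x ∧ x ≤ n • u}
  zero_mem' := ⟨0, by simp⟩
  add_mem' := by
    rintro x y ⟨n, hnx, hxn⟩ ⟨m, hmy, hym⟩
    refine ⟨n + m, ?_, ?_⟩
    · rw [add_smul, neg_add]
      exact add_le_add hnx hmy
    · rw [add_smul]
      exact add_le_add hxn hym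
  neg_mem' := by
    rintro x ⟨n, hnx, hxn⟩
    exact ⟨n, neg_le_neg hxn, neg_le.1 hnx⟩

theorem nsmul_mem_principalOrderIdeal {u : G} (hu : 0 ≤ u) (n : ℕ) :
    n • u ∈ principalOrderIdeal u :=
  ⟨n, neg_le_self (nsmul_nonneg hu n), le_rfl⟩

theorem isOrderIdeal_principalOrderIdeal {u : G} (hu : 0 ≤ u) :
    IsOrderIdeal (principalOrderIdeal u) where
  convex := by
    rintro x y hx hxy ⟨n, -, hyn⟩
    exact ⟨n, (neg_nonpos.2 (nsmul_nonneg hu n)).trans hx, hxy.trans hyn⟩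
  directed := by
    rintro x ⟨n, hnx, hxn⟩
    have hn := nsmul_mem_principalOrderIdeal hu n
    exact ⟨x + n • u, add_mem ⟨n, hnx, hxn⟩ hn, n • u, hn, neg_le_iff_add_nonneg.1 hnx,
      nsmul_nonneg hu n, (add_sub_cancel_right x (n • u)).symm⟩

namespace IsSimpleOrderedGroup

theorem exists_le_nsmul (hsimple : IsSimpleOrderedGroup G) {u : G} (hu : 0 < u) (x : G) :
    ∃ n : ℕ, x ≤ n • u := by
  have htop : principalOrderIdeal u = ⊤ :=
    (hsimple.eq_bot_or_eq_top _ (isOrderIdeal_principalOrderIdeal hu.le)).resolve_left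
      fun hbot ↦ hu.ne' <| by
        simpa [hbot] using nsmul_mem_principalOrderIdeal hu.le 1
  obtain ⟨n, -, hn⟩ : x ∈ principalOrderIdeal u := htop ▸ AddSubgroup.mem_top x
  exact ⟨n, hn⟩

theorem exists_pos (hsimple : IsSimpleOrderedGroup G)
    (hdir : ∀ g : G, ∃ a b : G, 0 ≤ a ∧ 0 ≤ b ∧ g = a - b) : ∃ u : G, 0 < u := by
  by_contra! hcon
  have eq_zero {a : G} (ha : 0 ≤ a) : a = 0 := by
    by_contra hne
    exact hcon a (ha.lt_of_ne' hne)
  obtain ⟨g, hg⟩ := @exists_ne G hsimple.nontrivial 0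
  obtain ⟨a, b, ha, hb, rfl⟩ := hdir g
  exact hg (by rw [eq_zero ha, eq_zero hb, sub_zero])

end IsSimpleOrderedGroup

theorem IsTrace.apply_pos (hsimple : IsSimpleOrderedGroup G) {τ : G →+ ℝ} (hτ : IsTrace τ)
    {g : G} (hg : 0 < g) : 0 < τ g := by
  refine (hτ.nonneg g hg.le).lt_of_ne fun h0 ↦ hτ.ne_zero ?_
  have nonpos (x : G) : τ x ≤ 0 := by
    obtain ⟨n, hn⟩ := hsimple.exists_le_nsmul hg x
    simpa [← h0] using hτ.nonneg _ (sub_nonneg.2 hn)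
  ext x
  exact (nonpos x).antisymm (by simpa using nonpos (-x))

/-- The order of `G` is the strict order induced by `τ`, that is, `G⁺` is `{g | 0 < τ g} ∪ {0}`. -/
def InducesStrictOrder (τ : G →+ ℝ) : Prop :=
  ∀ g : G, 0 < g ↔ 0 < τ g

theorem IsDimensionGroup.inducesStrictOrder (hdim : IsDimensionGroup G)
    (hsimple : IsSimpleOrderedGroup G) (htrace : HasUniqueTrace G) {τ : G →+ ℝ}
    (hτ : IsTrace τ) : InducesStrictOrder τ := by
  refine fun g ↦ ⟨hτ.apply_pos hsimple, fun hg ↦ ?_⟩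
  have hne : g ≠ 0 := by
    rintro rfl
    simp at hg
  refine lt_of_le_of_ne' ?_ hne
  by_contra hnonneg
  obtain ⟨u, hu⟩ := hsimple.exists_pos hdim.directed
  obtain ⟨σ, hσ, hσg⟩ := exists_isTrace_apply_nonpos hdim.unperforated hu
    (hsimple.exists_le_nsmul hu) hnonneg
  obtain ⟨c, hc, hσ_eq⟩ := htrace.unique τ σ hτ hσ
  exact hσg.not_gt (hσ_eq g ▸ mul_pos hc hg)

theorem IsDimensionGroup.isAddTorsionFree (hdim : IsDimensionGroup G) : IsAddTorsionFree G :=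
  .of_not_isOfFinAddOrder fun g hg hfin ↦ by
    obtain ⟨n, hn, hng⟩ := isOfFinAddOrder_iff_nsmul_eq_zero.1 hfin
    have hg_nonneg : 0 ≤ g := hdim.unperforated n g hn hng.ge
    have hg_nonpos : 0 ≤ -g := hdim.unperforated n (-g) hn (by rw [smul_neg, hng, neg_zero])
    exact hg ((neg_nonneg.1 hg_nonpos).antisymm hg_nonneg)

end Traces

section SimultaneousApproximation

variable {ι : Type*}

theorem exists_pos_forall_le_of_finite [Finite ι] {α : Type*} [LinearOrder α] [Zero α]
    [NoMaxOrder α] {f : ι → α} (hf : ∀ i, 0 < f i) : ∃ ε, 0 < ε ∧ ∀ i, ε ≤ f i := by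
  have : Nonempty {a : α // 0 < a} := nonempty_subtype.2 (exists_gt 0)
  obtain ⟨ε, hε⟩ := Finite.exists_ge fun i ↦ (⟨f i, hf i⟩ : {a : α // 0 < a})
  exact ⟨ε, ε.2, hε⟩

open Filter Topology in
theorem frequently_forall_abs_sub_round_lt [Finite ι] (t : ι → ℝ) {ε : ι → ℝ}
    (hε : ∀ j, 0 < ε j) : ∃ᶠ N : ℕ in atTop, ∀ j, |N * t j - round (N * t j)| < ε j := by
  have hnhds : ∀ᶠ y in 𝓝 (0 : ι → UnitAddCircle), ∀ j, ‖y j‖ < ε j := by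
    refine eventually_all.2 fun j ↦ ?_
    have hcont : ContinuousAt (fun y : ι → UnitAddCircle ↦ ‖y j‖) 0 :=
      (continuous_apply j).norm.continuousAt
    exact hcont.eventually_lt_const (by simpa using hε j)
  refine ((mapClusterPt_zero_atTop_nsmul fun j ↦ (t j : UnitAddCircle)).frequently hnhds).mono
    fun N hN j ↦ ?_
  have hcoe : N • (t j : UnitAddCircle) = ((N * t j : ℝ) : UnitAddCircle) := by
    rw [← AddCircle.coe_nsmul, nsmul_eq_mul]
  rw [← UnitAddCircle.norm_eq, ← hcoe]
  exact hN j

open Filter in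
theorem exists_gt_forall_mul_sub_intCast_mem_Ioo [Finite ι] {t : ι → ℝ} (ht : ∀ j, 0 < t j)
    {δ : ℝ} (hδ : 0 < δ) (C : ℝ) :
    ∃ β > C, ∃ n : ι → ℤ, ∀ j, β * t j - n j ∈ Set.Ioo 0 δ := by
  obtain ⟨η, hη, hηt⟩ := exists_pos_forall_le_of_finite fun j ↦ div_pos (half_pos hδ) (ht j)
  obtain ⟨N, hN, hCN⟩ :=
    ((frequently_forall_abs_sub_round_lt t fun j ↦ mul_pos hη (ht j)).and_eventually
      (eventually_ge_atTop ⌈C⌉₊)).exists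
  -- Each `N * t j` is within `η * t j` of an integer, so the errors of `N + η` are positive.
  refine ⟨N + η, by linarith [Nat.ceil_le.1 hCN], fun j ↦ round (N * t j), fun j ↦ ?_⟩
  have hηδ : η * t j ≤ δ / 2 := (le_div_iff₀ (ht j)).1 (hηt j)
  have hround := abs_lt.1 (hN j)
  constructor <;> linarith [add_mul (N : ℝ) η (t j)]

theorem exists_mem_forall_sub_intCast_mul_mem_Ioo [Finite ι] {S : Set ℝ} (hS : Dense S)
    {t : ι → ℝ} (ht : ∀ j, 0 < t j) {δ ε : ℝ} (hδ : 0 < δ) (hε : 0 < ε) :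
    ∃ α ∈ S, α ∈ Set.Ioo 0 ε ∧ ∃ n : ι → ℤ, ∀ j, t j - n j * α ∈ Set.Ioo 0 (δ * α) := by
  obtain ⟨β, hβ, n, hn⟩ := exists_gt_forall_mul_sub_intCast_mem_Ioo ht hδ ε⁻¹
  have hβ_pos : 0 < β := (inv_pos.2 hε).trans hβ
  have hopen : IsOpen {α : ℝ | α ∈ Set.Ioo 0 ε ∧ ∀ j, t j - n j * α ∈ Set.Ioo 0 (δ * α)} := by
    simp only [Set.ofPred_and, Set.ofPred_forall]
    refine isOpen_Ioo.inter (isOpen_iInter_of_finite fun j ↦ ?_)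
    exact (isOpen_lt (by fun_prop) (by fun_prop)).and (isOpen_lt (by fun_prop) (by fun_prop))
  have hβ_mem (j) : t j - n j * β⁻¹ ∈ Set.Ioo 0 (δ * β⁻¹) := by
    have hscale : t j - n j * β⁻¹ = (β * t j - n j) * β⁻¹ := by field_simp
    rw [hscale]
    exact ⟨mul_pos (hn j).1 (inv_pos.2 hβ_pos), mul_lt_mul_of_pos_right (hn j).2 (inv_pos.2 hβ_pos)⟩
  obtain ⟨α, ⟨hα, hαn⟩, hαS⟩ := hS.inter_open_nonempty _ hopen
    ⟨β⁻¹, ⟨inv_pos.2 hβ_pos, inv_lt_of_inv_lt₀ hε hβ⟩, hβ_mem⟩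
  exact ⟨α, hαS, hα, n, hαn⟩

theorem exists_mem_mul_sum_sub_intCast_mul_lt [Fintype ι] {S : Set ℝ} (hS : Dense S)
    {t : ι → ℝ} (ht : ∀ j, 0 < t j) (M : ℕ) {ε : ℝ} (hε : 0 < ε) :
    ∃ α ∈ S, α < ε ∧ ∃ n : ι → ℤ, (∀ j, 0 < t j - n j * α) ∧ M * ∑ j, (t j - n j * α) < α := by
  obtain ⟨α, hαS, hα, n, hn⟩ := exists_mem_forall_sub_intCast_mul_mem_Ioo hS ht
    (δ := (M * Fintype.card ι + 1 : ℝ)⁻¹) (by positivity) hε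
  refine ⟨α, hαS, hα.2, n, fun j ↦ (hn j).1, ?_⟩
  calc M * ∑ j, (t j - n j * α)
      ≤ M * ∑ _j : ι, (M * Fintype.card ι + 1 : ℝ)⁻¹ * α := by
        gcongr with j
        exact (hn j).2.le
    _ = M * Fintype.card ι / (M * Fintype.card ι + 1) * α := by
        simp only [Finset.sum_const, Finset.card_univ, nsmul_eq_mul]
        ring
    _ < α := mul_lt_of_lt_one_left hα.1 ((div_lt_one (by positivity)).2 (lt_add_one _))

end SimultaneousApproximation

section FiniteFreeModules

theorem exists_basis_forall_map_pos {F R : Type*} [AddCommGroup F] [Module.Finite ℤ F]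
    [Module.Free ℤ F] [AddCommGroup R] [LinearOrder R] [IsOrderedAddMonoid R] [Archimedean R]
    {τ : F →+ R} (hτ : τ ≠ 0) :
    ∃ b : Module.Basis (Fin (Module.finrank ℤ F)) ℤ F, ∀ j, 0 < τ (b j) := by
  obtain ⟨b, i, hi⟩ : ∃ (b : Module.Basis (Fin (Module.finrank ℤ F)) ℤ F) (i : _),
      0 < τ (b i) := by
    let b := Module.finBasis ℤ F
    obtain ⟨i, hi⟩ : ∃ i, τ (b i) ≠ 0 := by
      by_contra! hzero
      exact hτ (AddMonoidHom.toIntLinearMap_injective (b.ext hzero))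
    rcases hi.lt_or_gt with hneg | hpos
    · exact ⟨b.map (LinearEquiv.neg ℤ), i, by simpa using hneg⟩
    · exact ⟨b, i, hpos⟩
  -- Add to every other basis vector a large multiple of `b i`.
  have hm (j) : ∃ m : ℕ, 0 < τ (b j) + m • τ (b i) := by
    obtain ⟨m, hm⟩ := exists_lt_nsmul hi (-τ (b j))
    exact ⟨m, neg_lt_iff_pos_add'.1 hm⟩
  choose m hm using hm
  let l : F →ₗ[ℤ] ℤ := b.constr ℤ (Function.update (fun j ↦ (m j : ℤ)) i 0)
  have hl : l (b i) = 0 := by simp [l]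
  refine ⟨b.map (LinearEquiv.transvection hl), fun j ↦ ?_⟩
  rcases eq_or_ne j i with rfl | hj
  · simpa [LinearMap.transvection.apply, hl] using hi
  · simpa [LinearMap.transvection.apply, l, hj] using hm j

theorem finrank_add_finrank_ker_le_of_le_range {R V W : Type*} [CommRing R] [IsDomain R]
    [AddCommGroup V] [Module R V] [Module.Finite R V] [AddCommGroup W] [Module R W]
    {φ : V →ₗ[R] W} {F : Submodule R W} (hF : F ≤ LinearMap.range φ) :
    Module.finrank R F + Module.finrank R (LinearMap.ker φ) ≤ Module.finrank R V := by
  rw [← (LinearMap.ker φ).finrank_quotient_add_finrank, φ.quotKerEquivRange.finrank_eq]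
  gcongr
  exact Submodule.finrank_mono hF

end FiniteFreeModules

/-- A finite family in `G⁺` whose group of integer relations has rank at most
one: the data of a positive homomorphism `ℤ ^ card → G` with kernel of rank at most one. -/
structure CoRankOneFamily (G : Type*) [AddCommGroup G] [PartialOrder G] where
  card : ℕ
  elem : Fin card → G
  nonneg : ∀ i, 0 ≤ elem i
  finrank_ker_le_one : Module.finrank ℤ (LinearMap.ker (Fintype.linearCombination ℤ elem)) ≤ 1

namespace CoRankOneFamily

variable {G : Type*} [AddCommGroup G] [PartialOrder G]

/-- The homomorphism `ℤ ^ card → G` that sends the standard basis to the family. -/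
def toMap (x : CoRankOneFamily G) : (Fin x.card → ℤ) →ₗ[ℤ] G :=
  Fintype.linearCombination ℤ x.elem

theorem toMap_nonneg [IsOrderedAddMonoid G] (x : CoRankOneFamily G) {v : Fin x.card → ℤ}
    (hv : 0 ≤ v) : 0 ≤ x.toMap v := by
  rw [toMap, Fintype.linearCombination_apply]
  exact Finset.sum_nonneg fun i _ ↦ zsmul_nonneg (x.nonneg i) (hv i)

/-- The subgroup generated by `T` lifts along the homomorphism `ℤ ^ card → G` of the family, in
such a way that the elements of `T` in `G⁺` lift to nonnegative vectors. -/
def Lifts (x : CoRankOneFamily G) (T : Set G) : Prop :=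
  ∃ B : Submodule.span ℤ T →ₗ[ℤ] (Fin x.card → ℤ),
    (∀ v, x.toMap (B v) = v) ∧ ∀ v : Submodule.span ℤ T, (v : G) ∈ T → 0 ≤ (v : G) → 0 ≤ B v

theorem Lifts.mono {x : CoRankOneFamily G} {S T : Set G} (h : x.Lifts T) (hST : S ⊆ T) :
    x.Lifts S := by
  obtain ⟨B, hB, hB_nonneg⟩ := h
  exact ⟨B ∘ₗ Submodule.inclusion (Submodule.span_mono hST), fun v ↦ hB _,
    fun v hvS hv ↦ hB_nonneg _ (hST hvS) hv⟩

end CoRankOneFamily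

section DenseCase

variable {G : Type*} [AddCommGroup G] {F : Submodule ℤ G} {r : ℕ}
  (b : Module.Basis (Fin r) ℤ F) (y : G) (n : Fin r → ℤ) (M : ℤ)

/-- The errors in the approximation of the basis `b` by the multiples `n j • y` of `y`. -/
noncomputable def approxError (j : Fin r) : G :=
  b j - n j • y

/-- With the errors `w j = b j - n j • y`, the family `y - M • ∑ j, w j, w 0, …, w (r - 1)`. -/
noncomputable def shearedFamily : Fin (r + 1) → G :=
  Fin.cons (y - M • ∑ j, approxError b y n j) (approxError b y n)

/-- Coefficients of `v = ∑ j, c j • b j` in the sheared family: for `N = ∑ j, c j * n j`, one has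
`v = N • y + ∑ j, c j • w j = N • (y - M • ∑ j, w j) + ∑ j, (M * N + c j) • w j`. -/
noncomputable def shearedCoord : F →ₗ[ℤ] (Fin (r + 1) → ℤ) :=
  LinearMap.pi (Fin.cons (b.constr ℤ n) fun j ↦ M • b.constr ℤ n + b.coord j)

theorem eq_constr_smul_add_sum_approxError (v : F) :
    (v : G) = b.constr ℤ n v • y + ∑ j, b.repr v j • approxError b y n j := by
  have hv : (v : G) = ∑ j, b.repr v j • (b j : G) := by
    have h := congrArg F.subtype (b.sum_repr v)
    rw [map_sum] at h
    exact h.symm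
  rw [hv, b.constr_apply_fintype ℤ n v, Finset.sum_smul, ← Finset.sum_add_distrib]
  refine Finset.sum_congr rfl fun j _ ↦ ?_
  simp only [approxError, Module.Basis.equivFun_apply]
  module

theorem linearCombination_shearedCoord (v : F) :
    Fintype.linearCombination ℤ (shearedFamily b y n M) (shearedCoord b n M v) = v := by
  rw [Fintype.linearCombination_apply, Fin.sum_univ_succ,
    eq_constr_smul_add_sum_approxError b y n v]
  simp only [shearedFamily, shearedCoord, LinearMap.pi_apply, Fin.cons_zero, Fin.cons_succ,
    LinearMap.add_apply, LinearMap.smul_apply, Module.Basis.coord_apply, add_smul,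
    Finset.sum_add_distrib, ← Finset.smul_sum]
  module

theorem finrank_ker_linearCombination_shearedFamily_le_one :
    Module.finrank ℤ (LinearMap.ker (Fintype.linearCombination ℤ (shearedFamily b y n M))) ≤ 1 := by
  have hF : F ≤ LinearMap.range (Fintype.linearCombination ℤ (shearedFamily b y n M)) :=
    fun v hv ↦ ⟨shearedCoord b n M ⟨v, hv⟩, linearCombination_shearedCoord b y n M ⟨v, hv⟩⟩
  have hrank := finrank_add_finrank_ker_le_of_le_range hF
  rw [Module.finrank_eq_card_basis b, Module.finrank_fin_fun, Fintype.card_fin] at hrank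
  omega

variable {b y n M} {τ : G →+ ℝ}

theorem constr_pos (hw : ∀ j, 0 < τ (approxError b y n j))
    (hy : M * ∑ j, τ (approxError b y n j) < τ y) {v : F} (hM : ∀ j, |b.repr v j| ≤ M)
    (hv : τ y ≤ τ v) (hy_pos : 0 < τ y) : 0 < b.constr ℤ n v := by
  have htrace : τ v = b.constr ℤ n v * τ y + ∑ j, b.repr v j * τ (approxError b y n j) := by
    conv_lhs => rw [eq_constr_smul_add_sum_approxError b y n v]
    simp only [map_add, map_sum, map_zsmul, zsmul_eq_mul]
  have herror : ∑ j, b.repr v j * τ (approxError b y n j) ≤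
      M * ∑ j, τ (approxError b y n j) := by
    rw [Finset.mul_sum]
    gcongr with j
    · exact (hw j).le
    · exact (le_abs_self _).trans (hM j)
  have hmul : 0 < (b.constr ℤ n v : ℝ) * τ y := by linarith
  exact_mod_cast pos_of_mul_pos_left hmul hy_pos.le

theorem shearedCoord_nonneg {v : F} (hM : ∀ j, |b.repr v j| ≤ M) (hv : 0 < b.constr ℤ n v) :
    0 ≤ shearedCoord b n M v := by
  refine fun i ↦ Fin.cases hv.le (fun j ↦ ?_) i
  change 0 ≤ M * b.constr ℤ n v + b.repr v j
  have hM_nonneg : 0 ≤ M := (abs_nonneg _).trans (hM j)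
  linarith [neg_le_of_abs_le (hM j), le_mul_of_one_le_right hM_nonneg hv]

variable [PartialOrder G]

theorem shearedFamily_nonneg (hτ : InducesStrictOrder τ)
    (hw : ∀ j, 0 < τ (approxError b y n j)) (hy : M * ∑ j, τ (approxError b y n j) < τ y)
    (i : Fin (r + 1)) : 0 ≤ shearedFamily b y n M i := by
  refine ((hτ _).2 ?_).le
  refine Fin.cases ?_ hw i
  simpa [shearedFamily] using hy

theorem exists_lifts_of_dense (hτ : InducesStrictOrder τ) (hdense : Dense (Set.range τ))
    [IsAddTorsionFree G] {T : Set G} (hT : T.Finite) (hTpos : ∃ t ∈ T, 0 < t) :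
    ∃ x : CoRankOneFamily G, x.Lifts T := by
  have : Module.Finite ℤ (Submodule.span ℤ T) := .span_of_finite ℤ hT
  obtain ⟨b, hb⟩ : ∃ b : Module.Basis (Fin _) ℤ (Submodule.span ℤ T), ∀ j, 0 < τ (b j) := by
    obtain ⟨t, ht, htpos⟩ := hTpos
    refine exists_basis_forall_map_pos (τ := τ.comp (Submodule.span ℤ T).subtype.toAddMonoidHom)
      fun hzero ↦ ((hτ t).1 htpos).ne' ?_
    exact DFunLike.congr_fun hzero ⟨t, Submodule.subset_span ht⟩
  let P := {v : Submodule.span ℤ T // (v : G) ∈ T ∧ 0 < (v : G)}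
  have : Finite P :=
    ((hT.preimage Subtype.val_injective.injOn).subset fun _ hv ↦ hv.1).to_subtype
  obtain ⟨M, hM⟩ := Finite.exists_le fun p : P × Fin _ ↦ (b.repr p.1.1 p.2).natAbs
  obtain ⟨ε, hε, hεP⟩ := exists_pos_forall_le_of_finite fun v : P ↦ (hτ _).1 v.2.2
  obtain ⟨_, ⟨y, rfl⟩, hyε, n, hn, hsum⟩ := exists_mem_mul_sum_sub_intCast_mul_lt hdense hb M hε
  have hτw (j) : τ (approxError b y n j) = τ (b j) - n j * τ y := by simp [approxError]
  simp only [← hτw] at hn hsum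
  have hy_pos : 0 < τ y :=
    (mul_nonneg M.cast_nonneg (Finset.sum_nonneg fun j _ ↦ (hn j).le)).trans_lt hsum
  refine ⟨⟨_, shearedFamily b y n M, shearedFamily_nonneg hτ hn (mod_cast hsum),
    finrank_ker_linearCombination_shearedFamily_le_one b y n M⟩, shearedCoord b n M,
    linearCombination_shearedCoord b y n M, fun v hvT hv ↦ ?_⟩
  rcases hv.eq_or_lt with hzero | hpos
  · obtain rfl : v = 0 := Subtype.ext hzero.symm
    rw [map_zero]
  · have hMv (j) : |b.repr v j| ≤ M := by
      rw [Int.abs_eq_natAbs]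
      exact_mod_cast hM (⟨v, hvT, hpos⟩, j)
    exact shearedCoord_nonneg hMv <|
      constr_pos hn (mod_cast hsum) hMv (hyε.le.trans (hεP ⟨v, hvT, hpos⟩)) hy_pos

end DenseCase

section DiscreteCase

variable {G : Type*} [AddCommGroup G] [PartialOrder G] [IsOrderedAddMonoid G] {τ : G →+ ℝ}

theorem eq_zero_of_map_eq_zero_of_isLeast
    (hinterp : ∀ a b c d : G, a ≤ c → a ≤ d → b ≤ c → b ≤ d →
      ∃ e : G, a ≤ e ∧ b ≤ e ∧ e ≤ c ∧ e ≤ d)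
    (hτ : InducesStrictOrder τ) {u : G} (hu : IsLeast {a | a ∈ τ.range ∧ 0 < a} (τ u)) {k : G}
    (hk : τ k = 0) : k = 0 := by
  have eq_of_le {x y : G} (hxy : x ≤ y) (hτxy : τ y ≤ τ x) : x = y :=
    hxy.eq_of_not_lt fun hlt ↦ by
      have := (hτ _).1 (sub_pos.2 hlt)
      rw [map_sub] at this
      linarith
  have hu_pos : 0 < τ u := hu.1.2
  obtain ⟨e, h0e, hke, heu, heuk⟩ := hinterp 0 k u (u + k)
    ((hτ _).2 hu_pos).le ((hτ _).2 (by simpa [hk])).le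
    (sub_pos.1 ((hτ _).2 (by simpa [hk]))).le (by simpa using ((hτ _).2 hu_pos).le)
  rcases h0e.eq_or_lt with rfl | he
  · exact eq_of_le hke (by simp [hk])
  · obtain rfl : e = u := eq_of_le heu (hu.2 ⟨⟨e, rfl⟩, (hτ e).1 he⟩)
    exact (eq_of_le (by simpa using heuk) (by simp [hk])).symm

theorem zmultiples_eq_top_of_isLeast
    (hinterp : ∀ a b c d : G, a ≤ c → a ≤ d → b ≤ c → b ≤ d →
      ∃ e : G, a ≤ e ∧ b ≤ e ∧ e ≤ c ∧ e ≤ d)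
    (hτ : InducesStrictOrder τ) {u : G} (hu : IsLeast {a | a ∈ τ.range ∧ 0 < a} (τ u)) :
    AddSubgroup.zmultiples u = ⊤ := by
  refine (AddSubgroup.eq_top_iff' _).2 fun g ↦ ?_
  have hg : τ g ∈ AddSubgroup.closure {τ u} := AddSubgroup.cyclic_of_min hu ▸ ⟨g, rfl⟩
  obtain ⟨n, hn⟩ := AddSubgroup.mem_closure_singleton.1 hg
  refine ⟨n, (sub_eq_zero.1 ?_).symm⟩
  exact eq_zero_of_map_eq_zero_of_isLeast hinterp hτ hu (by rw [map_sub, map_zsmul, hn, sub_self])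

theorem exists_lifts_of_zmultiples_eq_top {u : G} (hu : 0 < u)
    (htop : AddSubgroup.zmultiples u = ⊤) (T : Set G) : ∃ x : CoRankOneFamily G, x.Lifts T := by
  have hmono : StrictMono fun n : ℤ ↦ n • u := zsmul_left_strictMono hu
  have hsurj : Function.Surjective fun n : ℤ ↦ n • u := (AddSubgroup.eq_top_iff' _).1 htop
  let e : ℤ ≃ₗ[ℤ] G :=
    LinearEquiv.ofBijective (LinearMap.toSpanSingleton ℤ G u) ⟨hmono.injective, hsurj⟩
  have hsmul (g : G) : e.symm g • u = g := e.apply_symm_apply g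
  let x : CoRankOneFamily G :=
    { card := 1
      elem := fun _ ↦ u
      nonneg := fun _ ↦ hu.le
      finrank_ker_le_one := (Submodule.finrank_le _).trans (by simp) }
  refine ⟨x, LinearMap.pi fun _ ↦ e.symm.toLinearMap ∘ₗ Submodule.subtype _, fun v ↦ ?_,
    fun v _ hv i ↦ ?_⟩
  · rw [CoRankOneFamily.toMap, Fintype.linearCombination_apply, Fin.sum_univ_one]
    exact hsmul v
  · exact hmono.le_iff_le.1 (show (0 : ℤ) • u ≤ e.symm v • u by rwa [zero_zsmul, hsmul])

end DiscreteCase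

theorem IsDimensionGroup.exists_lifts {G : Type*} [AddCommGroup G] [PartialOrder G]
    [IsOrderedAddMonoid G] (hdim : IsDimensionGroup G) {τ : G →+ ℝ} (hτ : InducesStrictOrder τ)
    {u : G} (hu : 0 < u) {T : Set G} (hT : T.Finite) : ∃ x : CoRankOneFamily G, x.Lifts T := by
  have := hdim.isAddTorsionFree
  by_cases hmin : ∃ a, IsLeast {a | a ∈ τ.range ∧ 0 < a} a
  · obtain ⟨_, hleast⟩ := hmin
    obtain ⟨a, rfl⟩ := hleast.1.1
    exact exists_lifts_of_zmultiples_eq_top ((hτ a).2 hleast.1.2)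
      (zmultiples_eq_top_of_isLeast hdim.interpolation hτ hleast) T
  · have hrange : τ.range ≠ ⊥ := by
      intro hbot
      have hmem : τ u ∈ τ.range := ⟨u, rfl⟩
      rw [hbot, AddSubgroup.mem_bot] at hmem
      exact ((hτ u).1 hu).ne' hmem
    obtain ⟨x, hx⟩ := exists_lifts_of_dense hτ (AddSubgroup.dense_of_no_min _ hrange hmin)
      (hT.insert u) ⟨u, Set.mem_insert _ _, hu⟩
    exact ⟨x, hx.mono (Set.subset_insert _ _)⟩

namespace CoRankOneFamily

variable {G : Type*} [AddCommGroup G] [PartialOrder G] {x y : CoRankOneFamily G} {T : Set G}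

theorem Lifts.exists_nonneg_toMap_eq (hy : y.Lifts T) {g : G} (hgT : g ∈ T) (hg : 0 ≤ g) :
    ∃ v, 0 ≤ v ∧ y.toMap v = g := by
  obtain ⟨B, hB, hB_nonneg⟩ := hy
  exact ⟨B ⟨g, Submodule.subset_span hgT⟩, hB_nonneg _ hgT hg, hB _⟩

theorem Lifts.exists_matrix (hy : y.Lifts T) (hxT : Set.range x.elem ⊆ T) :
    ∃ A : Matrix (Fin y.card) (Fin x.card) ℤ, (∀ i j, 0 ≤ A i j) ∧
      (∀ v, y.toMap (A.mulVec v) = x.toMap v) ∧ ∀ v, x.toMap v = 0 → A.mulVec v = 0 := by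
  obtain ⟨B, hB, hB_nonneg⟩ := hy
  have hx_single (j) : x.toMap (Pi.single j 1) = x.elem j := by simp [toMap]
  have hx_span (v) : x.toMap v ∈ Submodule.span ℤ T :=
    Submodule.span_mono hxT (Fintype.range_linearCombination ℤ x.elem ▸ ⟨v, rfl⟩)
  let C := B ∘ₗ x.toMap.codRestrict _ hx_span
  refine ⟨LinearMap.toMatrix' C, fun i j ↦ ?_, fun v ↦ ?_, fun v hv ↦ ?_⟩
  · rw [LinearMap.toMatrix'_apply]
    refine hB_nonneg _ ?_ ?_ i <;> rw [LinearMap.codRestrict_apply, hx_single]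
    exacts [hxT ⟨j, rfl⟩, x.nonneg j]
  · rw [LinearMap.toMatrix'_mulVec]
    exact hB _
  · have hzero : x.toMap.codRestrict _ hx_span v = 0 := Subtype.ext hv
    rw [LinearMap.toMatrix'_mulVec, LinearMap.comp_apply, hzero, map_zero]

end CoRankOneFamily

section MatrixLimit

variable {f : ℕ → ℕ} (A : ∀ n : ℕ, Matrix (Fin (f (n + 1))) (Fin (f n)) ℤ)

theorem telescopedMap_self (n : ℕ) (v : Fin (f n) → ℤ) : telescopedMap A n n le_rfl v = v := by
  simp [telescopedMap, telescopedProduct, Nat.leRecOn_self]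

theorem telescopedMap_succ {n m : ℕ} (h : n ≤ m) (v : Fin (f n) → ℤ) :
    telescopedMap A n (m + 1) (h.trans m.le_succ) v = (A m).mulVec (telescopedMap A n m h v) := by
  simp [telescopedMap, telescopedProduct, Nat.leRecOn_succ h, Matrix.mulVec_mulVec]

theorem limitClass_mulVec (n : ℕ) (v : Fin (f n) → ℤ) :
    limitClass A (n + 1) ((A n).mulVec v) = limitClass A n v := by
  rw [← telescopedMap_self A n v, ← telescopedMap_succ A le_rfl, telescopedMap_self]
  exact Module.DirectLimit.of_f

variable {A} {G : Type*} [AddCommGroup G] {φ : ∀ n, (Fin (f n) → ℤ) →ₗ[ℤ] G}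
  (hφ : ∀ n v, φ (n + 1) ((A n).mulVec v) = φ n v)

include hφ

theorem apply_telescopedMap (n m : ℕ) (h : n ≤ m) (v : Fin (f n) → ℤ) :
    φ m (telescopedMap A n m h v) = φ n v := by
  induction m, h using Nat.le_induction with
  | base => rw [telescopedMap_self]
  | succ m h ih => rw [telescopedMap_succ A h, hφ, ih]

theorem finrank_ker_telescopedMap_le (n m : ℕ) (h : n ≤ m) :
    Module.finrank ℤ (LinearMap.ker (telescopedMap A n m h)) ≤
      Module.finrank ℤ (LinearMap.ker (φ n)) := by
  refine Submodule.finrank_mono fun v hv ↦ ?_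
  rw [LinearMap.mem_ker] at hv ⊢
  rw [← apply_telescopedMap hφ n m h, hv, map_zero]

/-- The homomorphism `[v, n] ↦ φ n v` out of the direct limit. -/
noncomputable def limitLift : MatrixLimit A →ₗ[ℤ] G :=
  Module.DirectLimit.lift ℤ ℕ _ _ φ (apply_telescopedMap hφ)

theorem limitLift_limitClass (n : ℕ) (v : Fin (f n) → ℤ) :
    limitLift hφ (limitClass A n v) = φ n v :=
  Module.DirectLimit.lift_of φ (apply_telescopedMap hφ) v

theorem limitLift_injective (hker : ∀ n v, φ n v = 0 → (A n).mulVec v = 0) :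
    Function.Injective (limitLift hφ) := by
  refine (injective_iff_map_eq_zero _).2 fun z hz ↦ ?_
  obtain ⟨n, v, rfl⟩ : ∃ n v, limitClass A n v = z := Module.DirectLimit.exists_of z
  rw [limitLift_limitClass] at hz
  rw [← limitClass_mulVec, hker n v hz, limitClass, map_zero]

variable [PartialOrder G]

theorem image_limitLift_limitCone (hnonneg : ∀ n v, 0 ≤ v → 0 ≤ φ n v)
    (hreach : ∀ g, 0 ≤ g → ∃ n v, 0 ≤ v ∧ φ n v = g) :
    limitLift hφ '' limitCone A = {g | 0 ≤ g} := by
  ext g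
  constructor
  · rintro ⟨_, ⟨n, v, hv, rfl⟩, rfl⟩
    exact (hnonneg n v hv).trans_eq (limitLift_limitClass hφ n v).symm
  · intro hg
    obtain ⟨n, v, hv, rfl⟩ := hreach g hg
    exact ⟨_, ⟨n, v, hv, rfl⟩, limitLift_limitClass hφ n v⟩

theorem exists_addEquiv_matrixLimit (hdir : ∀ g : G, ∃ a b : G, 0 ≤ a ∧ 0 ≤ b ∧ g = a - b)
    (hker : ∀ n v, φ n v = 0 → (A n).mulVec v = 0) (hnonneg : ∀ n v, 0 ≤ v → 0 ≤ φ n v)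
    (hreach : ∀ g, 0 ≤ g → ∃ n v, 0 ≤ v ∧ φ n v = g) :
    ∃ e : G ≃+ MatrixLimit A, ∀ g, 0 ≤ g ↔ e g ∈ limitCone A := by
  have hcone := image_limitLift_limitCone hφ hnonneg hreach
  have hinj := limitLift_injective hφ hker
  have hsurj : Function.Surjective (limitLift hφ) := by
    intro g
    obtain ⟨a, b, ha, hb, rfl⟩ := hdir g
    obtain ⟨y, -, rfl⟩ := hcone.ge ha
    obtain ⟨z, -, rfl⟩ := hcone.ge hb
    exact ⟨y - z, map_sub _ y z⟩
  let e := (LinearEquiv.ofBijective (limitLift hφ) ⟨hinj, hsurj⟩).toAddEquiv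
  refine ⟨e.symm, fun g ↦ ?_⟩
  obtain ⟨z, rfl⟩ := e.surjective g
  rw [e.symm_apply_apply, ← hinj.mem_set_image, hcone]
  rfl

end MatrixLimit

theorem isCoRankOneUltrasimplicial_of_exists_lifts {G : Type*} [AddCommGroup G] [PartialOrder G]
    [IsOrderedAddMonoid G] [Countable G]
    (hdir : ∀ g : G, ∃ a b : G, 0 ≤ a ∧ 0 ≤ b ∧ g = a - b)
    (hlift : ∀ T : Set G, T.Finite → ∃ x : CoRankOneFamily G, x.Lifts T) :
    IsCoRankOneUltrasimplicial G := by
  choose next hnext using fun (x : CoRankOneFamily G) (g : G) ↦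
    hlift (insert g (Set.range x.elem)) ((Set.finite_range _).insert g)
  obtain ⟨γ, hγ⟩ := exists_surjective_nat G
  obtain ⟨x₀, -⟩ := hlift ∅ Set.finite_empty
  let x : ℕ → CoRankOneFamily G := Nat.rec x₀ fun n x ↦ next x (γ n)
  have hx (n) : (x (n + 1)).Lifts (insert (γ n) (Set.range (x n).elem)) := hnext (x n) (γ n)
  choose A hA hcomm hker using fun n ↦ (hx n).exists_matrix (Set.subset_insert _ _)
  let f (n : ℕ) : ℕ := (x n).card
  let φ (n : ℕ) : (Fin (f n) → ℤ) →ₗ[ℤ] G := (x n).toMap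
  refine ⟨f, A, hA, ?_, fun n m h ↦
    (finrank_ker_telescopedMap_le (φ := φ) hcomm n m h).trans (x n).finrank_ker_le_one⟩
  refine exists_addEquiv_matrixLimit (φ := φ) hcomm hdir hker
    (fun n v ↦ (x n).toMap_nonneg) fun g hg ↦ ?_
  obtain ⟨n, rfl⟩ := hγ g
  exact ⟨n + 1, (hx n).exists_nonneg_toMap_eq (Set.mem_insert _ _) hg⟩

theorem theorem5p1 (G : Type*) [AddCommGroup G] [PartialOrder G] [IsOrderedAddMonoid G]
    [Countable G] (hdim : IsDimensionGroup G) (hsimple : IsSimpleOrderedGroup G)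
    (htrace : HasUniqueTrace G) : IsCoRankOneUltrasimplicial G := by
  obtain ⟨τ, hτ⟩ := htrace.exists_trace
  have horder : InducesStrictOrder τ := hdim.inducesStrictOrder hsimple htrace hτ
  obtain ⟨u, hu⟩ := hsimple.exists_pos hdim.directed
  exact isCoRankOneUltrasimplicial_of_exists_lifts hdim.directed fun T hT ↦
    hdim.exists_lifts horder hu hT
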